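/- Proposition 2.2. Let $V$ be a complex vector space of finite dimension $n$ and let $d\eta$ be any Haar (Lebesgue) measure on $V$. A pseudonorm on $V$ is a function $F:V\to[0,\infty)$ with $F(v)=0$ only for $v=0$ and $F(cv)=|c|F(v)$ for $c\in\mathbb C$, $v\in V$; the triangle inequality is not required. Put $\Omega_F=\{F<1\}$. All pseudonorms are assumed to be such that $\Omega_F$ is Lebesgue measurable, has finite volume $|\Omega_F|$, and $\int_{\Omega_F}|\theta(\eta)|^2d\eta<\infty$ for every $\theta\in V^*$ (this is automatic in (1) and (5), and for every continuous pseudonorm). Then $$\mathfrak g_F^*(\theta,\phi)=\frac{n+1}{|\Omega_F|}\int_{\Omega_F}\theta(\eta)\overline{\phi(\eta)}\,d\eta\qquad(\theta,\phi\in V^*)$$ is a Hermitian inner product on $V^*=\operatorname{Hom}_{\mathbb C}(V,\mathbb C)$, and so there is for every $v\in V$ a unique $\check v\in V^*$ with $\phi(v)=\mathfrak g_F^*(\phi,\check v)$ for all $\phi\in V^*$. The complex Binet–Legendre inner product of $F$ is the dual form $\mathfrak g_F(v,w)=\mathfrak g_F^*(\check w,\check v)$; it is a Hermitian inner product on $V$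 (Hermitian inner products are linear in the first variable). The following hold. 1. If $h$ is a Hermitian inner product on $V$ and $F(v)=\sqrt{h(v,v)}$ for all $v$, then $\mathfrak g_F=h$. 2. If $A$ is a $\mathbb C$-linear automorphism of $V$ and $A^*F(v)=F(Av)$, then $\mathfrak g_{A^*F}(u,v)=\mathfrak g_F(Au,Av)$ for all $u,v\in V$. 3. Let $\alpha,\beta>0$ and let $F_1,F_2$ be pseudonorms on $V$ with $\alpha F_1\le F_2\le\beta F_1$. Then for each $v\in V$ $$\frac{\alpha^{n+1}}{\beta^n}\sqrt{\mathfrak g_{F_1}(v,v)}\le\sqrt{\mathfrak g_{F_2}(v,v)}\le\frac{\beta^{n+1}}{\alpha^n}\sqrt{\mathfrak g_{F_1}(v,v)}.$$ 4. Let $F_1,F_2$ be pseudonorms on $V$. If $\alpha,\beta>0$ satisfy $\alpha F_1\le F_2\le\beta F_1$ and one of the two inequalities in (3) is an equality for some $v\ne0$, then $\alpha=\beta$ and $F_2=\beta F_1$. If $n\ge1$, then there are $\alpha,\beta>0$ with $\alpha F_1\le F_2\le\beta F_1$ for which one of the two inequalities in (3) is an equality for some $v\neq 0$, if and only if $F_2=\beta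 F_1$ for some $\beta>0$. If $F_2=\beta F_1$ with $\beta>0$, then $\mathfrak g_{F_2}=\beta^2\mathfrak g_{F_1}$. 5. If a pseudonorm $F$ satisfies the triangle inequality, then for each $v\in V$ $$\frac1{n^{(n+1)/2}}F(v)\le\sqrt{\mathfrak g_F(v,v)}\le n^{(n+1)/2}F(v).$$ (For $n=0$ all terms are read as $0$.) -/

import Mathlib

open MeasureTheory

noncomputable section

namespace BinetLegendre

/-- All the axioms of a norm on a complex vector space, except the triangle inequality. -/
structure IsPseudonorm {V : Type*} [AddCommGroup V] [Module ℂ V] (F : V → ℝ) : Prop where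
  nonneg : ∀ v, 0 ≤ F v
  eq_zero_iff : ∀ v, F v = 0 ↔ v = 0
  smul : ∀ (c : ℂ) (v : V), F (c • v) = ‖c‖ * F v

/-- A Hermitian inner product, complex linear in the first variable, conjugate linear in the
second one, and positive definite. -/
structure IsHermitianInnerProduct {V : Type*} [AddCommGroup V] [Module ℂ V]
    (h : V → V → ℂ) : Prop where
  add_left : ∀ u v w, h (u + v) w = h u w + h v w
  smul_left : ∀ (c : ℂ) (v w : V), h (c • v) w = c * h v w
  conj_symm : ∀ v w, (starRingEnd ℂ) (h w v) = h v w
  pos : ∀ v, v ≠ 0 → 0 < (h v v).re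

/-- The open unit (pseudo)ball `{F < 1}`. -/
def unitBall {V : Type*} (F : V → ℝ) : Set V := {v | F v < 1}

section
variable {V : Type*} [NormedAddCommGroup V] [NormedSpace ℂ V] [MeasurableSpace V]

/-- The volume and the integrals in the definition of the dual inner product make sense:
the unit ball of `F` is Lebesgue measurable, has finite volume, and every complex linear functional
is square integrable on it. (For a norm this is automatic, and so it is for a
pseudonorm that is continuous.) -/
structure HasFiniteMoments (μ : Measure V) (F : V → ℝ) : Prop where
  nullMeasurableSet : NullMeasurableSet (unitBall F) μ
  volume_ne_top : μ (unitBall F) ≠ ⊤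
  integrable_sq : ∀ θ : Module.Dual ℂ V, IntegrableOn (fun η => ‖θ η‖ ^ 2) (unitBall F) μ

/-- The dual complex Binet-Legendre inner product
`g*_F(θ, φ) = (n + 1) / |Ω| * ∫_Ω θ(η) conj(φ(η)) dη`, where `Ω = {F < 1}`. -/
def dualInner (μ : Measure V) (F : V → ℝ) (θ φ : Module.Dual ℂ V) : ℂ :=
  (((Module.finrank ℂ V : ℝ) + 1) / μ.real (unitBall F) : ℝ) *
    ∫ η in unitBall F, θ η * (starRingEnd ℂ) (φ η) ∂μ

/-- The musical isomorphism `V → V*` of the inner product `g*_F`: the element `θ` of `V*` that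
represents the evaluation at `v`, that is, `φ(v) = g*_F(φ, θ)` for all `φ`. -/
def musical (μ : Measure V) (F : V → ℝ) (v : V) : Module.Dual ℂ V :=
  Classical.epsilon fun θ => ∀ φ : Module.Dual ℂ V, φ v = dualInner μ F φ θ

/-- The complex Binet-Legendre inner product `g_F`, the dual of `g*_F`. As the musical
isomorphism is conjugate linear, its arguments are exchanged, so that `g_F` is linear in the
first variable. -/
def blInner (μ : Measure V) (F : V → ℝ) (v w : V) : ℂ :=
  dualInner μ F (musical μ F w) (musical μ F v)

/-- `√(g_F(v, v))`. -/
def blNorm (μ : Measure V) (F : V → ℝ) (v : V) : ℝ := √(blInner μ F v v).re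

end

end BinetLegendre

end

open BinetLegendre

noncomputable section

namespace BinetLegendre

universe u

/-! ### Hermitian forms and norms as structures on a copy of the space -/

section Hermitian

variable {V : Type u} [AddCommGroup V] [Module ℂ V]

/-! Everything is read off the quadratic form `g*(θ, θ) = (n + 1) / |Ω| * ∫_Ω |θ|²` on the dual. It
is positive because `Ω` has positive measure while the kernel of a nonzero functional is null; Riesz
representation then gives the musical map and `g`.

A linear change of variables multiplies the integral and the volume by the same Jacobian, which
cancels; this is (2), and the automorphism `β • id` gives the scaling law in (4).

For (3), `β⁻¹Ω₁ ⊆ Ω₂ ⊆ α⁻¹Ω₁`. In real dimension `2n`, volumes scale with exponent `2n` and second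
moments with `2n + 2`, which compares the dual forms; Cauchy–Schwarz at the functional representing
`v` carries the bound to `V`. Equality forces equality for volumes and for moments. Equal volumes
give `Ω₂ = α⁻¹Ω₁` almost everywhere, so the moments scale by `α` as well as by `β`, and `α = β`
(`eq_of_blNorm_eq`).

For (1), unitary invariance makes the Gram matrix of `g*` in an orthonormal basis scalar, and the
trace, which is `(n + 1) / |Ω| * ∫_Ω F² = n` by polar coordinates, makes the scalar `1`.

For (5), a Hahn–Banach functional norming `v` is at most `1` in modulus on `Ω`, so `F² ≤ (n + 1) g`.
Conversely, if `F v ≤ 1` then convexity puts `tv + (1 - t)Ω` inside `Ω`, which bounds `∫_Ω |y|²`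
below in terms of `y v` (`le_setIntegral_normSq`). Dimension one is a case of (1). -/

theorem IsPseudonorm.exists_normedSpace {F : V → ℝ} (hF : IsPseudonorm F)
    (htri : ∀ v w, F (v + w) ≤ F v + F w) :
    ∃ (W : Type u) (_ : NormedAddCommGroup W) (_ : NormedSpace ℂ W) (e : W ≃ₗ[ℂ] V),
      ∀ w, ‖w‖ = F (e w) := by
  let : Norm V := ⟨F⟩
  have core : NormedSpace.Core ℂ V :=
    { norm_nonneg := hF.nonneg
      norm_smul := hF.smul
      norm_triangle := htri
      norm_eq_zero_iff := hF.eq_zero_iff }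
  let := NormedAddCommGroup.ofCore core
  let := NormedSpace.ofCore core
  exact ⟨V, inferInstance, inferInstance, LinearEquiv.refl ℂ V, fun _ => rfl⟩

namespace IsHermitianInnerProduct

variable {h : V → V → ℂ} (hh : IsHermitianInnerProduct h)
include hh

theorem zero_left (w : V) : h 0 w = 0 := by
  simpa using hh.smul_left 0 0 w

theorem re_self_nonneg (v : V) : 0 ≤ (h v v).re := by
  by_cases hv : v = 0
  · simp [hv, hh.zero_left]
  · exact (hh.pos v hv).le

theorem ofReal_re_self (v : V) : ((h v v).re : ℂ) = h v v :=
  Complex.conj_eq_iff_re.mp (hh.conj_symm v v)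

theorem add_right (u v w : V) : h u (v + w) = h u v + h u w := by
  rw [← hh.conj_symm, hh.add_left, map_add, hh.conj_symm, hh.conj_symm]

theorem smul_right (c : ℂ) (v w : V) : h v (c • w) = (starRingEnd ℂ) c * h v w := by
  rw [← hh.conj_symm, hh.smul_left, map_mul, hh.conj_symm]

theorem exists_innerProductSpace :
    ∃ (W : Type u) (_ : NormedAddCommGroup W) (_ : InnerProductSpace ℂ W) (e : W ≃ₗ[ℂ] V),
      ∀ x y, inner ℂ x y = h (e y) (e x) := by
  let core : InnerProductSpace.Core ℂ V :=
    -- The arguments are exchanged because `inner` is linear in its second variable.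
    { inner := fun x y => h y x
      conj_inner_symm := fun x y => hh.conj_symm y x
      re_inner_nonneg := hh.re_self_nonneg
      add_left := fun x y z => hh.add_right z x y
      smul_left := fun x y c => hh.smul_right c y x
      definite := fun x hx => by
        by_contra hne
        have := hh.pos x hne
        rw [show h x x = 0 from hx] at this
        simp at this }
  let := @InnerProductSpace.Core.toNormedAddCommGroup ℂ V _ _ _ core
  let := InnerProductSpace.ofCore core.toCore
  exact ⟨V, inferInstance, inferInstance, LinearEquiv.refl ℂ V, fun _ _ => rfl⟩

theorem norm_sq_le (v w : V) : ‖h v w‖ ^ 2 ≤ (h v v).re * (h w w).re := by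
  obtain ⟨W, _, _, e, he⟩ := hh.exists_innerProductSpace
  have h1 := norm_inner_le_norm (𝕜 := ℂ) (e.symm w) (e.symm v)
  have h2 : ∀ x, ‖e.symm x‖ ^ 2 = (h x x).re := fun x => by
    rw [← inner_self_eq_norm_sq (𝕜 := ℂ), he]
    simp
  rw [he, e.apply_symm_apply, e.apply_symm_apply] at h1
  calc ‖h v w‖ ^ 2 ≤ (‖e.symm w‖ * ‖e.symm v‖) ^ 2 := by gcongr
    _ = _ := by rw [mul_pow, h2, h2, mul_comm]

theorem ext_right {v w : V} (H : ∀ u, h u v = h u w) : v = w := by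
  by_contra hne
  have hpos := hh.pos _ (sub_ne_zero.mpr hne)
  have h1 : h (v - w) (v - w) = 0 := by
    rw [sub_eq_add_neg v w, ← neg_one_smul ℂ w, hh.add_right, hh.smul_right, H]
    simp
  simp [h1] at hpos

theorem exists_eq_apply [FiniteDimensional ℂ V] (L : Module.Dual ℂ V) :
    ∃ v, ∀ w, L w = h w v := by
  obtain ⟨W, _, _, e, he⟩ := hh.exists_innerProductSpace
  have : FiniteDimensional ℂ W := e.symm.finiteDimensional
  let L' : W →L[ℂ] ℂ := LinearMap.toContinuousLinearMap (L ∘ₗ e.toLinearMap)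
  refine ⟨e ((InnerProductSpace.toDual ℂ W).symm L'), fun w => ?_⟩
  have := InnerProductSpace.toDual_symm_apply (𝕜 := ℂ) (x := e.symm w) (y := L')
  rw [he, e.apply_symm_apply] at this
  rw [this]
  simp [L']

end IsHermitianInnerProduct

end Hermitian

/-! ### Moments of the unit ball and the musical isomorphism -/

section Moments

open Module Pointwise

variable {V : Type u} [NormedAddCommGroup V] [NormedSpace ℂ V]

namespace IsPseudonorm

variable {F : V → ℝ} (hF : IsPseudonorm F)
include hF

theorem smul_real (r : ℝ) (v : V) : F (r • v) = |r| * F v := by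
  rw [← Complex.coe_smul, hF.smul, Complex.norm_real, Real.norm_eq_abs]

theorem neg (v : V) : F (-v) = F v := by
  simpa using hF.smul_real (-1) v

theorem setOf_lt_eq_smul {r : ℝ} (hr : 0 < r) : {v | F v < r} = r • unitBall F := by
  ext v
  rw [Set.mem_smul_set_iff_inv_smul_mem₀ hr.ne', unitBall, Set.mem_ofPred_eq, Set.mem_ofPred_eq,
    hF.smul_real, abs_of_pos (inv_pos.mpr hr), inv_mul_lt_one₀ hr]

variable [FiniteDimensional ℂ V] [MeasurableSpace V] [BorelSpace V]
  (μ : Measure V) [μ.IsAddHaarMeasure]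

theorem measure_setOf_lt {r : ℝ} (hr : 0 < r) :
    μ {v | F v < r} = ENNReal.ofReal (r ^ (2 * finrank ℂ V)) * μ (unitBall F) := by
  rw [hF.setOf_lt_eq_smul hr, Measure.addHaar_smul_of_nonneg _ hr.le, finrank_real_of_complex]

theorem measureReal_setOf_lt {r : ℝ} (hr : 0 < r) :
    μ.real {v | F v < r} = r ^ (2 * finrank ℂ V) * μ.real (unitBall F) := by
  rw [measureReal_def, hF.measure_setOf_lt μ hr, ENNReal.toReal_mul,
    ENNReal.toReal_ofReal (by positivity), measureReal_def]

/-- The ball need not be open, but its dilates exhaust `V`, so they cannot all be null. -/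
theorem measure_unitBall_ne_zero : μ (unitBall F) ≠ 0 := by
  intro h0
  have hU : (⋃ k : ℕ, {v | F v < (k + 1 : ℝ)}) = Set.univ := by
    refine Set.eq_univ_of_forall fun v => Set.mem_iUnion.mpr ?_
    obtain ⟨k, hk⟩ := exists_nat_gt (F v)
    exact ⟨k, hk.trans (lt_add_one _)⟩
  have : μ (⋃ k : ℕ, {v | F v < (k + 1 : ℝ)}) = 0 :=
    measure_iUnion_null fun k => by rw [hF.measure_setOf_lt μ (by positivity), h0, mul_zero]
  rw [hU] at this
  exact IsOpen.measure_ne_zero μ isOpen_univ Set.univ_nonempty this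

theorem setIntegral_normSq_setOf_lt {r : ℝ} (hr : 0 < r) (θ : Dual ℂ V) :
    ∫ η in {v | F v < r}, ‖θ η‖ ^ 2 ∂μ =
      r ^ (2 * finrank ℂ V + 2) * ∫ η in unitBall F, ‖θ η‖ ^ 2 ∂μ := by
  have h := Measure.setIntegral_comp_smul_of_pos μ (fun η => ‖θ η‖ ^ 2) (unitBall F) hr
  rw [← hF.setOf_lt_eq_smul hr, finrank_real_of_complex, smul_eq_mul] at h
  have h2 : ∀ η, ‖θ (r • η)‖ ^ 2 = r ^ 2 * ‖θ η‖ ^ 2 := fun η => by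
    rw [← Complex.coe_smul, map_smul, norm_smul, mul_pow, Complex.norm_real, Real.norm_eq_abs,
      sq_abs]
  simp_rw [h2] at h
  rw [integral_const_mul, eq_inv_mul_iff_mul_eq₀ (by positivity)] at h
  rw [← h]
  ring

end IsPseudonorm

theorem continuous_dual [FiniteDimensional ℂ V] (θ : Dual ℂ V) : Continuous θ :=
  LinearMap.continuous_of_finiteDimensional θ

theorem dualInner_self [MeasurableSpace V] {μ : Measure V} {F : V → ℝ} (θ : Dual ℂ V) :
    dualInner μ F θ θ = (((finrank ℂ V : ℝ) + 1) / μ.real (unitBall F) *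
      ∫ η in unitBall F, ‖θ η‖ ^ 2 ∂μ : ℝ) := by
  rw [dualInner, Complex.ofReal_mul, ← integral_complex_ofReal]
  simp_rw [Complex.mul_conj, Complex.normSq_eq_norm_sq]

theorem re_dualInner_self [MeasurableSpace V] {μ : Measure V} {F : V → ℝ} (θ : Dual ℂ V) :
    (dualInner μ F θ θ).re = ((finrank ℂ V : ℝ) + 1) / μ.real (unitBall F) *
      ∫ η in unitBall F, ‖θ η‖ ^ 2 ∂μ := by
  rw [dualInner_self, Complex.ofReal_re]

theorem HasFiniteMoments.integrableOn_mul [FiniteDimensional ℂ V] [MeasurableSpace V]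
    [BorelSpace V] {μ : Measure V} {F : V → ℝ} (hM : HasFiniteMoments μ F)
    (θ φ : Dual ℂ V) :
    IntegrableOn (fun η => θ η * (starRingEnd ℂ) (φ η)) (unitBall F) μ := by
  refine Integrable.mono' ((hM.integrable_sq θ).add (hM.integrable_sq φ)) ?_ ?_
  · have := continuous_dual θ
    have := continuous_dual φ
    exact Continuous.aestronglyMeasurable (by fun_prop)
  · refine Filter.Eventually.of_forall fun η => ?_
    simp only [norm_mul, RCLike.norm_conj, Pi.add_apply]
    nlinarith [sq_nonneg (‖θ η‖ - ‖φ η‖), sq_nonneg ‖θ η‖, sq_nonneg ‖φ η‖]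

variable [FiniteDimensional ℂ V] [MeasurableSpace V] [BorelSpace V]
  {μ : Measure V} [μ.IsAddHaarMeasure] {F : V → ℝ}

namespace HasFiniteMoments

theorem measureReal_pos (hM : HasFiniteMoments μ F) (hF : IsPseudonorm F) :
    0 < μ.real (unitBall F) :=
  ENNReal.toReal_pos (hF.measure_unitBall_ne_zero μ) hM.volume_ne_top

theorem setIntegral_normSq_pos (hM : HasFiniteMoments μ F) (hF : IsPseudonorm F)
    {θ : Dual ℂ V} (hθ : θ ≠ 0) : 0 < ∫ η in unitBall F, ‖θ η‖ ^ 2 ∂μ := by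
  rw [setIntegral_pos_iff_support_of_nonneg_ae (Filter.Eventually.of_forall fun _ => by positivity)
    (hM.integrable_sq θ)]
  -- A proper subspace is null, so the part of the ball where `θ ≠ 0` keeps positive measure.
  have hker : μ (LinearMap.ker θ : Set V) = 0 := by
    refine Measure.addHaar_submodule μ ((LinearMap.ker θ).restrictScalars ℝ) ?_
    intro h
    exact hθ (LinearMap.ker_eq_top.mp ((Submodule.restrictScalars_eq_top_iff ℝ ℂ V).mp h))
  refine (pos_iff_ne_zero.mpr fun h0 => hF.measure_unitBall_ne_zero μ ?_)
  refine measure_mono_null (t := (Function.support (fun η => ‖θ η‖ ^ 2) ∩ unitBall F) ∪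
    (LinearMap.ker θ : Set V)) (fun v hv => ?_) (measure_union_null h0 hker)
  by_cases h : θ v = 0
  · exact Or.inr h
  · exact Or.inl ⟨by simpa using h, hv⟩

end HasFiniteMoments

theorem isHermitianInnerProduct_dualInner (hF : IsPseudonorm F) (hM : HasFiniteMoments μ F) :
    IsHermitianInnerProduct (dualInner μ F) where
  add_left u v w := by
    simp only [dualInner, LinearMap.add_apply, add_mul]
    rw [integral_add (hM.integrableOn_mul u w) (hM.integrableOn_mul v w), mul_add]
  smul_left c v w := by
    simp only [dualInner, LinearMap.smul_apply, smul_eq_mul, mul_assoc]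
    rw [integral_const_mul]
    ring
  conj_symm v w := by
    simp only [dualInner, map_mul, Complex.conj_ofReal]
    rw [← integral_conj]
    simp only [map_mul, Complex.conj_conj, mul_comm]
  pos v hv := by
    rw [re_dualInner_self]
    have := hM.measureReal_pos hF
    have := hM.setIntegral_normSq_pos hF hv
    positivity

theorem apply_eq_dualInner_musical (hF : IsPseudonorm F) (hM : HasFiniteMoments μ F) (v : V)
    (φ : Dual ℂ V) : φ v = dualInner μ F φ (musical μ F v) := by
  have h := Classical.epsilon_spec
    ((isHermitianInnerProduct_dualInner hF hM).exists_eq_apply (Dual.eval ℂ V v))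
  exact h φ

theorem musical_eq (hF : IsPseudonorm F) (hM : HasFiniteMoments μ F) {v : V} {θ : Dual ℂ V}
    (h : ∀ φ : Dual ℂ V, φ v = dualInner μ F φ θ) : musical μ F v = θ :=
  (isHermitianInnerProduct_dualInner hF hM).ext_right fun φ => by
    rw [← apply_eq_dualInner_musical hF hM, h]

theorem blInner_eq_apply (hF : IsPseudonorm F) (hM : HasFiniteMoments μ F) (v w : V) :
    blInner μ F v w = musical μ F w v := by
  rw [blInner, ← apply_eq_dualInner_musical hF hM]

theorem musical_ne_zero (hF : IsPseudonorm F) (hM : HasFiniteMoments μ F) {v : V} (hv : v ≠ 0) :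
    musical μ F v ≠ 0 := by
  intro h0
  refine hv ((forall_dual_apply_eq_zero_iff ℂ v).mp fun φ => ?_)
  rw [apply_eq_dualInner_musical hF hM, h0,
    ← (isHermitianInnerProduct_dualInner hF hM).conj_symm,
    (isHermitianInnerProduct_dualInner hF hM).zero_left, map_zero]

theorem isHermitianInnerProduct_blInner (hF : IsPseudonorm F) (hM : HasFiniteMoments μ F) :
    IsHermitianInnerProduct (blInner μ F) where
  add_left u v w := by simp only [blInner_eq_apply hF hM, map_add]
  smul_left c v w := by simp only [blInner_eq_apply hF hM, map_smul, smul_eq_mul]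
  conj_symm v w := (isHermitianInnerProduct_dualInner hF hM).conj_symm _ _
  pos v hv := (isHermitianInnerProduct_dualInner hF hM).pos _ (musical_ne_zero hF hM hv)

theorem blNorm_sq (hF : IsPseudonorm F) (hM : HasFiniteMoments μ F) (v : V) :
    blNorm μ F v ^ 2 = (blInner μ F v v).re :=
  Real.sq_sqrt ((isHermitianInnerProduct_blInner hF hM).re_self_nonneg v)

theorem blNorm_pos (hF : IsPseudonorm F) (hM : HasFiniteMoments μ F) {v : V} (hv : v ≠ 0) :
    0 < blNorm μ F v :=
  Real.sqrt_pos.mpr ((isHermitianInnerProduct_blInner hF hM).pos v hv)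

theorem apply_musical_self (hF : IsPseudonorm F) (hM : HasFiniteMoments μ F) (v : V) :
    musical μ F v v = (blNorm μ F v ^ 2 : ℝ) := by
  rw [blNorm_sq hF hM, (isHermitianInnerProduct_blInner hF hM).ofReal_re_self,
    blInner_eq_apply hF hM]

theorem re_dualInner_musical_self (hF : IsPseudonorm F) (hM : HasFiniteMoments μ F) (v : V) :
    (dualInner μ F (musical μ F v) (musical μ F v)).re = blNorm μ F v ^ 2 :=
  (blNorm_sq hF hM v).symm

theorem norm_apply_sq_le (hF : IsPseudonorm F) (hM : HasFiniteMoments μ F) (v : V)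
    (θ : Dual ℂ V) : ‖θ v‖ ^ 2 ≤ (dualInner μ F θ θ).re * blNorm μ F v ^ 2 := by
  rw [apply_eq_dualInner_musical hF hM, ← re_dualInner_musical_self hF hM]
  exact (isHermitianInnerProduct_dualInner hF hM).norm_sq_le _ _

end Moments

/-! ### Linear change of variables -/

section ChangeOfVariables

open Module

variable {V : Type u} [NormedAddCommGroup V] [NormedSpace ℂ V] [FiniteDimensional ℂ V]
  [MeasurableSpace V] [BorelSpace V] (μ : Measure V) [μ.IsAddHaarMeasure]

theorem exists_map_eq_smul (A : V ≃ₗ[ℂ] V) :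
    ∃ c : ℝ, 0 < c ∧ μ.map A = ENNReal.ofReal c • μ := by
  let f : V ≃ₗ[ℝ] V := A.restrictScalars ℝ
  have hdet : LinearMap.det (f : V →ₗ[ℝ] V) ≠ 0 := f.isUnit_det'.ne_zero
  exact ⟨_, abs_pos.mpr (inv_ne_zero hdet), Measure.map_linearMap_addHaar_eq_smul_addHaar μ hdet⟩

theorem measurableEmbedding_linearEquiv (A : V ≃ₗ[ℂ] V) : MeasurableEmbedding A :=
  A.toContinuousLinearEquiv.toHomeomorph.measurableEmbedding

/-- The Jacobian factor `c` appears in both the integral and the volume, and cancels in the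
quotient. -/
theorem dualInner_comp_linearEquiv (F : V → ℝ) (A : V ≃ₗ[ℂ] V) (θ φ : Dual ℂ V) :
    dualInner μ (fun x => F (A x)) (θ ∘ₗ A.toLinearMap) (φ ∘ₗ A.toLinearMap) =
      dualInner μ F θ φ := by
  obtain ⟨c, hc, hmap⟩ := exists_map_eq_smul μ A
  have hA := measurableEmbedding_linearEquiv A
  have hpre : unitBall (fun x => F (A x)) = A ⁻¹' unitBall F := rfl
  have h1 : μ.real (A ⁻¹' unitBall F) = c * μ.real (unitBall F) := by
    rw [measureReal_def, ← hA.map_apply, hmap, Measure.smul_apply, smul_eq_mul,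
      ENNReal.toReal_mul, ENNReal.toReal_ofReal hc.le, measureReal_def]
  have h2 := hA.setIntegral_map (μ := μ) (fun η => θ η * (starRingEnd ℂ) (φ η)) (unitBall F)
  rw [hmap, Measure.restrict_smul, integral_smul_measure, ENNReal.toReal_ofReal hc.le] at h2
  simp only [dualInner, LinearMap.comp_apply, LinearEquiv.coe_coe]
  rw [hpre, h1, ← h2, Complex.real_smul, ← mul_assoc, ← Complex.ofReal_mul]
  congr 2
  rw [div_mul_eq_mul_div, mul_comm c, mul_div_mul_right _ _ hc.ne']

end ChangeOfVariables

/-! ### Naturality and scaling of the inner product -/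

section Functoriality

open Module

theorem IsPseudonorm.comp_linearEquiv {V : Type*} [AddCommGroup V] [Module ℂ V] {F : V → ℝ}
    (hF : IsPseudonorm F) (A : V ≃ₗ[ℂ] V) :
    IsPseudonorm fun x => F (A x) where
  nonneg v := hF.nonneg _
  eq_zero_iff v := by rw [hF.eq_zero_iff, A.map_eq_zero_iff]
  smul c v := by rw [map_smul, hF.smul]

variable {V : Type u} [NormedAddCommGroup V] [NormedSpace ℂ V] [FiniteDimensional ℂ V]
  [MeasurableSpace V] [BorelSpace V] {μ : Measure V} [μ.IsAddHaarMeasure]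

theorem HasFiniteMoments.comp_linearEquiv {F : V → ℝ} (hM : HasFiniteMoments μ F)
    (A : V ≃ₗ[ℂ] V) : HasFiniteMoments μ fun x => F (A x) := by
  obtain ⟨c, hc, hmap⟩ := exists_map_eq_smul μ A
  have hA := measurableEmbedding_linearEquiv A
  have hpre : unitBall (fun x => F (A x)) = A ⁻¹' unitBall F := rfl
  refine ⟨?_, ?_, fun θ => ?_⟩
  · refine hM.nullMeasurableSet.preimage ⟨hA.measurable, ?_⟩
    rw [hmap]
    exact Measure.smul_absolutelyContinuous
  · rw [hpre, ← hA.map_apply, hmap, Measure.smul_apply, smul_eq_mul]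
    exact ENNReal.mul_ne_top ENNReal.ofReal_ne_top hM.volume_ne_top
  · have h := (hA.integrableOn_map_iff (μ := μ) (s := unitBall F)
      (f := fun η => ‖(θ ∘ₗ A.symm.toLinearMap) η‖ ^ 2)).mp (by
        rw [hmap, IntegrableOn, Measure.restrict_smul]
        exact (hM.integrable_sq _).smul_measure ENNReal.ofReal_ne_top)
    simpa [hpre, Function.comp_def] using h

theorem musical_comp_linearEquiv {F : V → ℝ} (hF : IsPseudonorm F) (hM : HasFiniteMoments μ F)
    (A : V ≃ₗ[ℂ] V) (v : V) :
    musical μ (fun x => F (A x)) v = musical μ F (A v) ∘ₗ A.toLinearMap := by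
  refine musical_eq (hF.comp_linearEquiv A) (hM.comp_linearEquiv A) fun φ => ?_
  have h : φ = (φ ∘ₗ A.symm.toLinearMap) ∘ₗ A.toLinearMap := by ext; simp
  rw [h, dualInner_comp_linearEquiv, ← apply_eq_dualInner_musical hF hM]
  simp

theorem blInner_comp_linearEquiv {F : V → ℝ} (hF : IsPseudonorm F) (hM : HasFiniteMoments μ F)
    (A : V ≃ₗ[ℂ] V) (u v : V) :
    blInner μ (fun x => F (A x)) u v = blInner μ F (A u) (A v) := by
  simp only [blInner, musical_comp_linearEquiv hF hM, dualInner_comp_linearEquiv]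

theorem blInner_const_mul {F : V → ℝ} (hF : IsPseudonorm F) (hM : HasFiniteMoments μ F) {β : ℝ}
    (hβ : 0 < β) (v w : V) :
    blInner μ (fun x => β * F x) v w = (β : ℂ) ^ 2 * blInner μ F v w := by
  have hβ' : (β : ℂ) ≠ 0 := Complex.ofReal_ne_zero.mpr hβ.ne'
  have h := blInner_comp_linearEquiv hF hM (LinearEquiv.smulOfNeZero ℂ V (β : ℂ) hβ') v w
  have hg := isHermitianInnerProduct_blInner hF hM
  simp only [LinearEquiv.smulOfNeZero_apply, hF.smul, Complex.norm_real, Real.norm_eq_abs,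
    abs_of_pos hβ, hg.smul_left, hg.smul_right, Complex.conj_ofReal] at h
  rw [h]
  ring

theorem blNorm_const_mul {F : V → ℝ} (hF : IsPseudonorm F) (hM : HasFiniteMoments μ F) {β : ℝ}
    (hβ : 0 < β) (v : V) : blNorm μ (fun x => β * F x) v = β * blNorm μ F v := by
  rw [blNorm, blInner_const_mul hF hM hβ, ← Complex.ofReal_pow, Complex.re_ofReal_mul,
    Real.sqrt_mul (by positivity), Real.sqrt_sq hβ.le, blNorm]

end Functoriality

/-! ### Comparison of two pseudonorms and rigidity -/

section Comparison

open Module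

theorem unitBall_subset_setOf_lt {V : Type*} {F₁ F₂ : V → ℝ} {α : ℝ} (hα : 0 < α)
    (h : ∀ v, α * F₁ v ≤ F₂ v) :
    unitBall F₂ ⊆ {v | F₁ v < α⁻¹} := fun v (hv : F₂ v < 1) =>
  (lt_inv_mul_iff₀ hα).mpr ((h v).trans_lt hv) |>.trans_eq (mul_one _)

theorem setOf_lt_subset_unitBall {V : Type*} {F₁ F₂ : V → ℝ} {β : ℝ} (hβ : 0 < β)
    (h : ∀ v, F₂ v ≤ β * F₁ v) :
    {v | F₁ v < β⁻¹} ⊆ unitBall F₂ := fun v (hv : F₁ v < β⁻¹) =>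
  (h v).trans_lt ((lt_inv_mul_iff₀ hβ).mp (hv.trans_eq (mul_one _).symm))

theorem comparison_symm {V : Type*} {F₁ F₂ : V → ℝ} {α β : ℝ} (hα : 0 < α) (hβ : 0 < β)
    (h : ∀ v, α * F₁ v ≤ F₂ v ∧ F₂ v ≤ β * F₁ v) (v : V) :
    β⁻¹ * F₂ v ≤ F₁ v ∧ F₁ v ≤ α⁻¹ * F₂ v :=
  ⟨(inv_mul_le_iff₀ hβ).mpr (h v).2, (le_inv_mul_iff₀ hα).mpr (h v).1⟩

variable {V : Type u} [NormedAddCommGroup V] [NormedSpace ℂ V] [FiniteDimensional ℂ V]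
  [MeasurableSpace V] [BorelSpace V] {μ : Measure V} [μ.IsAddHaarMeasure] {F₁ F₂ : V → ℝ}
  {α β : ℝ}

theorem measureReal_unitBall_le (hF₁ : IsPseudonorm F₁) (hM₁ : HasFiniteMoments μ F₁)
    (hα : 0 < α) (h : ∀ v, α * F₁ v ≤ F₂ v) :
    α ^ (2 * finrank ℂ V) * μ.real (unitBall F₂) ≤ μ.real (unitBall F₁) := by
  have h1 : μ.real (unitBall F₂) ≤ μ.real {v | F₁ v < α⁻¹} := by
    refine measureReal_mono (unitBall_subset_setOf_lt hα h) ?_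
    rw [hF₁.measure_setOf_lt μ (inv_pos.mpr hα)]
    exact ENNReal.mul_ne_top ENNReal.ofReal_ne_top hM₁.volume_ne_top
  rwa [hF₁.measureReal_setOf_lt μ (inv_pos.mpr hα), inv_pow, le_inv_mul_iff₀ (by positivity)]
    at h1

theorem setIntegral_normSq_unitBall_le (hF₁ : IsPseudonorm F₁) (hM₂ : HasFiniteMoments μ F₂)
    (hβ : 0 < β) (h : ∀ v, F₂ v ≤ β * F₁ v) (θ : Dual ℂ V) :
    ∫ η in unitBall F₁, ‖θ η‖ ^ 2 ∂μ ≤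
      β ^ (2 * finrank ℂ V + 2) * ∫ η in unitBall F₂, ‖θ η‖ ^ 2 ∂μ := by
  have h1 : ∫ η in {v | F₁ v < β⁻¹}, ‖θ η‖ ^ 2 ∂μ ≤ ∫ η in unitBall F₂, ‖θ η‖ ^ 2 ∂μ :=
    setIntegral_mono_set (hM₂.integrable_sq θ) (Filter.Eventually.of_forall fun _ => by positivity)
      (setOf_lt_subset_unitBall hβ h).eventuallyLE
  rwa [hF₁.setIntegral_normSq_setOf_lt μ (inv_pos.mpr hβ), inv_pow,
    inv_mul_le_iff₀ (by positivity)] at h1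

theorem re_dualInner_self_le (hF₁ : IsPseudonorm F₁) (hM₁ : HasFiniteMoments μ F₁)
    (hF₂ : IsPseudonorm F₂) (hM₂ : HasFiniteMoments μ F₂) (hα : 0 < α) (hβ : 0 < β)
    (h : ∀ v, α * F₁ v ≤ F₂ v ∧ F₂ v ≤ β * F₁ v) (θ : Dual ℂ V) :
    (dualInner μ F₁ θ θ).re ≤
      (β ^ (finrank ℂ V + 1) / α ^ finrank ℂ V) ^ 2 * (dualInner μ F₂ θ θ).re := by
  have h1 := measureReal_unitBall_le hF₁ hM₁ hα fun v => (h v).1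
  have h2 := setIntegral_normSq_unitBall_le hF₁ hM₂ hβ (fun v => (h v).2) θ
  have h3 := hM₂.measureReal_pos hF₂
  have h4 : 0 ≤ ∫ η in unitBall F₂, ‖θ η‖ ^ 2 ∂μ := integral_nonneg fun _ => by positivity
  rw [re_dualInner_self, re_dualInner_self]
  calc _ ≤ ((finrank ℂ V : ℝ) + 1) / (α ^ (2 * finrank ℂ V) * μ.real (unitBall F₂)) *
        (β ^ (2 * finrank ℂ V + 2) * ∫ η in unitBall F₂, ‖θ η‖ ^ 2 ∂μ) := by gcongr
    _ = _ := by
      field_simp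
      ring

theorem blNorm_le (hF₁ : IsPseudonorm F₁) (hM₁ : HasFiniteMoments μ F₁)
    (hF₂ : IsPseudonorm F₂) (hM₂ : HasFiniteMoments μ F₂) (hα : 0 < α) (hβ : 0 < β)
    (h : ∀ v, α * F₁ v ≤ F₂ v ∧ F₂ v ≤ β * F₁ v) (v : V) :
    blNorm μ F₂ v ≤ β ^ (finrank ℂ V + 1) / α ^ finrank ℂ V * blNorm μ F₁ v := by
  -- With `θ` representing `v` for `F₂` and `Nᵢ` the norms of `v`, both `θ v` and `g₂*(θ, θ)` equal
  -- `N₂²`. Hence `N₂⁴ ≤ g₁*(θ, θ) N₁² ≤ K² N₂² N₁²`.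
  have h1 := norm_apply_sq_le hF₁ hM₁ v (musical μ F₂ v)
  have h2 := re_dualInner_self_le hF₁ hM₁ hF₂ hM₂ hα hβ h (musical μ F₂ v)
  rw [re_dualInner_musical_self hF₂ hM₂] at h2
  rw [apply_musical_self hF₂ hM₂, Complex.norm_real, Real.norm_eq_abs, sq_abs] at h1
  set K := β ^ (finrank ℂ V + 1) / α ^ finrank ℂ V
  have hK : 0 < K := by positivity
  have h0 : 0 ≤ blNorm μ F₁ v := Real.sqrt_nonneg _
  have h0' : 0 ≤ blNorm μ F₂ v := Real.sqrt_nonneg _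
  rcases h0'.eq_or_lt with h3 | h3
  · rw [← h3]
    positivity
  · have h4 : blNorm μ F₂ v ^ 2 * blNorm μ F₂ v ^ 2 ≤
        blNorm μ F₂ v ^ 2 * (K * blNorm μ F₁ v) ^ 2 :=
      calc _ = (blNorm μ F₂ v ^ 2) ^ 2 := by ring
        _ ≤ _ := h1
        _ ≤ K ^ 2 * blNorm μ F₂ v ^ 2 * blNorm μ F₁ v ^ 2 := by gcongr
        _ = _ := by ring
    exact (sq_le_sq₀ h3.le (by positivity)).mp (le_of_mul_le_mul_left h4 (by positivity))

theorem eq_of_blNorm_eq (hF₁ : IsPseudonorm F₁) (hM₁ : HasFiniteMoments μ F₁)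
    (hF₂ : IsPseudonorm F₂) (hM₂ : HasFiniteMoments μ F₂) (hα : 0 < α) (hβ : 0 < β)
    (h : ∀ v, α * F₁ v ≤ F₂ v ∧ F₂ v ≤ β * F₁ v) {v : V} (hv : v ≠ 0)
    (heq : blNorm μ F₂ v = β ^ (finrank ℂ V + 1) / α ^ finrank ℂ V * blNorm μ F₁ v) :
    α = β := by
  have hN₁ := blNorm_pos (μ := μ) hF₁ hM₁ hv
  set θ := musical μ F₂ v with hθ
  have hθ0 : θ ≠ 0 := musical_ne_zero hF₂ hM₂ hv
  have h1 := norm_apply_sq_le hF₁ hM₁ v θ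
  have hQ₂ := re_dualInner_musical_self hF₂ hM₂ v
  rw [hθ, apply_musical_self hF₂ hM₂, Complex.norm_real, Real.norm_eq_abs, sq_abs, ← hθ] at h1
  rw [← hθ] at hQ₂
  have hvol := measureReal_unitBall_le hF₁ hM₁ hα fun v => (h v).1
  have hint := setIntegral_normSq_unitBall_le hF₁ hM₂ hβ (fun v => (h v).2) θ
  have ha₁ := hM₁.measureReal_pos hF₁
  have ha₂ := hM₂.measureReal_pos hF₂
  have hI₁ := hM₁.setIntegral_normSq_pos hF₁ hθ0
  have hI₂ := hM₂.setIntegral_normSq_pos hF₂ hθ0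
  -- The reverse of `re_dualInner_self_le` at this `θ`. It makes the volume bound and the moment
  -- bound behind that estimate equalities (`hvol'`, `hint'`).
  have h2 : (β ^ (finrank ℂ V + 1) / α ^ finrank ℂ V) ^ 2 * (dualInner μ F₂ θ θ).re ≤
      (dualInner μ F₁ θ θ).re := by
    rw [hQ₂]
    refine le_of_mul_le_mul_right (le_of_eq_of_le ?_ h1) (pow_pos hN₁ 2)
    rw [heq]
    ring
  rw [re_dualInner_self, re_dualInner_self] at h2
  set a₁ := μ.real (unitBall F₁)
  set a₂ := μ.real (unitBall F₂)
  set I₁ := ∫ η in unitBall F₁, ‖θ η‖ ^ 2 ∂μ with hI₁def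
  set I₂ := ∫ η in unitBall F₂, ‖θ η‖ ^ 2 ∂μ with hI₂def
  set n := finrank ℂ V
  have h3 : β ^ (2 * n + 2) * I₂ * a₁ ≤ I₁ * (α ^ (2 * n) * a₂) := by
    have e1 : (β ^ (n + 1) / α ^ n) ^ 2 * (((n : ℝ) + 1) / a₂ * I₂) =
        ((n : ℝ) + 1) * ((β ^ (2 * n + 2) * I₂) / (α ^ (2 * n) * a₂)) := by
      field_simp
      ring
    have e2 : ((n : ℝ) + 1) / a₁ * I₁ = ((n : ℝ) + 1) * (I₁ / a₁) := by ring
    rw [e1, e2] at h2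
    have := le_of_mul_le_mul_left h2 (by positivity)
    rwa [div_le_div_iff₀ (by positivity) ha₁] at this
  have hβI : 0 < β ^ (2 * n + 2) * I₂ := by positivity
  have hvol' : a₁ ≤ α ^ (2 * n) * a₂ := by
    refine le_of_mul_le_mul_left (h3.trans ?_) hβI
    gcongr
  have hint' : β ^ (2 * n + 2) * I₂ ≤ I₁ := by
    refine le_of_mul_le_mul_right (h3.trans ?_) ha₁
    gcongr
  have hαinv := inv_pos.mpr hα
  -- One set contains the other and the finite volumes agree; equality up to a null set suffices to
  -- transfer the moment.
  have hae : unitBall F₂ =ᵐ[μ] {v | F₁ v < α⁻¹} := by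
    have hfin : μ {v | F₁ v < α⁻¹} ≠ ⊤ := by
      rw [hF₁.measure_setOf_lt μ hαinv]
      exact ENNReal.mul_ne_top ENNReal.ofReal_ne_top hM₁.volume_ne_top
    refine ae_eq_of_subset_of_measure_ge (unitBall_subset_setOf_lt hα fun v => (h v).1) ?_
      hM₂.nullMeasurableSet hfin
    refine (ENNReal.toReal_le_toReal hfin hM₂.volume_ne_top).mp ?_
    rw [← measureReal_def, ← measureReal_def, hF₁.measureReal_setOf_lt μ hαinv, inv_pow,
      inv_mul_le_iff₀ (by positivity)]
    exact hvol'
  have h5 : I₂ = α⁻¹ ^ (2 * n + 2) * I₁ := by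
    rw [hI₂def, setIntegral_congr_set hae, hF₁.setIntegral_normSq_setOf_lt μ hαinv]
  have h6 : β ^ (2 * n + 2) ≤ α ^ (2 * n + 2) := by
    rw [h5, inv_pow, ← mul_assoc, ← div_eq_mul_inv] at hint'
    have := le_of_mul_le_mul_right (hint'.trans_eq (one_mul _).symm) hI₁
    rwa [div_le_one (by positivity)] at this
  have h7 : β ≤ α := le_of_pow_le_pow_left₀ (by positivity) hα.le h6
  have h8 : 0 < F₁ v := lt_of_le_of_ne (hF₁.nonneg v) fun h0 => hv ((hF₁.eq_zero_iff v).mp h0.symm)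
  exact le_antisymm (le_of_mul_le_mul_right ((h v).1.trans (h v).2) h8) h7

/-- The upper bound with the roles of `F₁` and `F₂` exchanged and constants `β⁻¹`, `α⁻¹`. -/
theorem le_blNorm (hF₁ : IsPseudonorm F₁) (hM₁ : HasFiniteMoments μ F₁)
    (hF₂ : IsPseudonorm F₂) (hM₂ : HasFiniteMoments μ F₂) (hα : 0 < α) (hβ : 0 < β)
    (h : ∀ v, α * F₁ v ≤ F₂ v ∧ F₂ v ≤ β * F₁ v) (v : V) :
    α ^ (finrank ℂ V + 1) / β ^ finrank ℂ V * blNorm μ F₁ v ≤ blNorm μ F₂ v := by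
  have h1 := blNorm_le (μ := μ) hF₂ hM₂ hF₁ hM₁ (inv_pos.mpr hβ) (inv_pos.mpr hα)
    (comparison_symm hα hβ h) v
  rw [inv_pow, inv_pow, inv_div_inv, div_mul_eq_mul_div, le_div_iff₀ (by positivity)] at h1
  rwa [div_mul_eq_mul_div, div_le_iff₀ (by positivity), mul_comm, mul_comm (blNorm μ F₂ v)]

theorem eq_of_eq_blNorm (hF₁ : IsPseudonorm F₁) (hM₁ : HasFiniteMoments μ F₁)
    (hF₂ : IsPseudonorm F₂) (hM₂ : HasFiniteMoments μ F₂) (hα : 0 < α) (hβ : 0 < β)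
    (h : ∀ v, α * F₁ v ≤ F₂ v ∧ F₂ v ≤ β * F₁ v) {v : V} (hv : v ≠ 0)
    (heq : α ^ (finrank ℂ V + 1) / β ^ finrank ℂ V * blNorm μ F₁ v = blNorm μ F₂ v) :
    α = β := by
  refine (inv_inj.mp (eq_of_blNorm_eq (μ := μ) hF₂ hM₂ hF₁ hM₁ (inv_pos.mpr hβ)
    (inv_pos.mpr hα) (comparison_symm hα hβ h) hv ?_)).symm
  rw [← heq, inv_pow, inv_pow]
  field_simp

end Comparison

/-! ### Pseudonorms with the triangle inequality: finiteness and the radial second moment -/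

section Norms

open Module

variable {V : Type u} [NormedAddCommGroup V] [NormedSpace ℂ V] [FiniteDimensional ℂ V]
  [MeasurableSpace V] [BorelSpace V] {F : V → ℝ}

theorem IsPseudonorm.hasFiniteMoments (μ : Measure V) [IsFiniteMeasureOnCompacts μ]
    (hF : IsPseudonorm F) (htri : ∀ v w, F (v + w) ≤ F v + F w) : HasFiniteMoments μ F := by
  obtain ⟨W, _, _, e, he⟩ := hF.exists_normedSpace htri
  have : FiniteDimensional ℂ W := e.symm.finiteDimensional
  have : ProperSpace W := FiniteDimensional.proper ℂ W
  have hFe : F = fun v => ‖e.symm v‖ := funext fun v => by rw [he, e.apply_symm_apply]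
  have hc : Continuous F := by
    rw [hFe]
    exact e.symm.toContinuousLinearEquiv.continuous.norm
  have hK : IsCompact (e '' Metric.closedBall 0 1) :=
    (isCompact_closedBall (0 : W) 1).image e.toContinuousLinearEquiv.continuous
  have hsub : unitBall F ⊆ e '' Metric.closedBall 0 1 := fun v (hv : F v < 1) => by
    refine ⟨e.symm v, ?_, e.apply_symm_apply v⟩
    rw [mem_closedBall_zero_iff]
    rw [hFe] at hv
    exact hv.le
  refine ⟨(isOpen_lt hc continuous_const).measurableSet.nullMeasurableSet,
    measure_ne_top_of_subset hsub hK.measure_lt_top.ne, fun θ => ?_⟩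
  exact ((continuous_dual θ).norm.pow 2).continuousOn.integrableOn_compact hK |>.mono_set hsub

theorem setIntegral_indicator_pow (n : ℕ) (hn : n ≠ 0) :
    ∫ y in Set.Ioi (0 : ℝ), y ^ (2 * n - 1) • (Set.Iio (1 : ℝ)).indicator (fun y => y ^ 2) y =
      1 / (2 * n + 2) := by
  have h1 : ∀ y : ℝ, y ^ (2 * n - 1) • (Set.Iio (1 : ℝ)).indicator (fun y => y ^ 2) y =
      (Set.Iio (1 : ℝ)).indicator (fun y => y ^ (2 * n + 1)) y := fun y => by
    by_cases hy : y ∈ Set.Iio (1 : ℝ)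
    · rw [Set.indicator_of_mem hy, Set.indicator_of_mem hy, smul_eq_mul, ← pow_add]
      congr 1
      omega
    · simp [Set.indicator_of_notMem hy]
  simp_rw [h1]
  rw [setIntegral_indicator measurableSet_Iio, Set.Ioi_inter_Iio, ← integral_Ioc_eq_integral_Ioo,
    ← intervalIntegral.integral_of_le zero_le_one, integral_pow]
  push_cast
  simp
  ring

/-- Polar coordinates for the norm `F` in real dimension `2n`: the ratio to the volume is `2n ∫₀¹
r^(2n-1) r² dr = 2n / (2n + 2)`. -/
theorem IsPseudonorm.setIntegral_sq (μ : Measure V) [μ.IsAddHaarMeasure]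
    (hF : IsPseudonorm F) (htri : ∀ v w, F (v + w) ≤ F v + F w) :
    ∫ v in unitBall F, F v ^ 2 ∂μ =
      (finrank ℂ V : ℝ) / (finrank ℂ V + 1) * μ.real (unitBall F) := by
  obtain ⟨W, _, _, e, he⟩ := hF.exists_normedSpace htri
  have : FiniteDimensional ℂ W := e.symm.finiteDimensional
  have hFe : F = fun v => ‖e.symm v‖ := funext fun v => by rw [he, e.apply_symm_apply]
  rcases subsingleton_or_nontrivial V with hV | hV
  · have h0 : ∀ v, F v = 0 := fun v => (hF.eq_zero_iff v).mpr (Subsingleton.elim _ _)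
    simp [h0, finrank_zero_of_subsingleton]
  have : Nontrivial W := e.toEquiv.nontrivial
  let : MeasurableSpace W := borel W
  have : BorelSpace W := ⟨rfl⟩
  let L : V ≃L[ℂ] W := e.symm.toContinuousLinearEquiv
  have hL : ∀ v, ‖L v‖ = F v := fun v => (congrFun hFe v).symm
  have hLm : MeasurableEmbedding L := L.toHomeomorph.measurableEmbedding
  have : (μ.map L).IsAddHaarMeasure :=
    (L.toContinuousAddEquiv).isAddHaarMeasure_map μ
  have hmeas : MeasurableSet (unitBall F) := by
    rw [hFe]
    exact (isOpen_lt L.continuous.norm continuous_const).measurableSet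
  have hball : L ⁻¹' Metric.ball 0 1 = unitBall F := by
    ext v
    simp [unitBall, hL]
  have h1 := integral_fun_norm_addHaar (μ.map L) ((Set.Iio (1 : ℝ)).indicator fun y => y ^ 2)
  have hn : finrank ℂ V ≠ 0 := finrank_pos.ne'
  rw [hLm.integral_map, finrank_real_of_complex, ← e.symm.finrank_eq,
    setIntegral_indicator_pow _ hn, measureReal_def, hLm.map_apply, hball, ← measureReal_def] at h1
  have h2 : ∀ v, (Set.Iio (1 : ℝ)).indicator (fun y => y ^ 2) ‖L v‖ =
      (unitBall F).indicator (fun v => F v ^ 2) v := fun v => by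
    rw [hL]
    rfl
  simp_rw [h2] at h1
  rw [integral_indicator hmeas] at h1
  rw [h1, nsmul_eq_mul, smul_eq_mul]
  push_cast
  field_simp

end Norms

/-! ### The norm of a Hermitian inner product -/

section HermitianNorm

open Module

theorem IsHermitianInnerProduct.sum_left {V : Type u} [AddCommGroup V] [Module ℂ V]
    {h : V → V → ℂ} (hh : IsHermitianInnerProduct h) {ι : Type*} (s : Finset ι) (c : ι → ℂ)
    (v : ι → V) (w : V) : h (∑ i ∈ s, c i • v i) w = ∑ i ∈ s, c i * h (v i) w := by
  let L : V →ₗ[ℂ] ℂ :=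
    { toFun := fun v => h v w
      map_add' := fun u v => hh.add_left u v w
      map_smul' := fun c v => hh.smul_left c v w }
  change L _ = _
  rw [map_sum]
  exact Finset.sum_congr rfl fun i _ => hh.smul_left _ _ _

variable {V : Type u} [NormedAddCommGroup V] [NormedSpace ℂ V]
  {W : Type u} [NormedAddCommGroup W] [InnerProductSpace ℂ W]

/-- The functional `⟪a, ·⟫`, transported from an inner product space `W`. -/
def innerDual (e : W ≃ₗ[ℂ] V) (a : W) : Dual ℂ V :=
  (innerSL ℂ a).toLinearMap ∘ₗ e.symm.toLinearMap

theorem innerDual_apply (e : W ≃ₗ[ℂ] V) (a : W) (v : V) :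
    innerDual e a v = inner ℂ a (e.symm v) := rfl

theorem isPseudonorm_norm_symm (e : W ≃ₗ[ℂ] V) : IsPseudonorm fun v => ‖e.symm v‖ where
  nonneg v := norm_nonneg _
  eq_zero_iff v := by simp
  smul c v := by rw [map_smul, norm_smul]

variable [FiniteDimensional ℂ V] [MeasurableSpace V] [BorelSpace V] (μ : Measure V)
  [μ.IsAddHaarMeasure]

/-- The conjugate of `U` by `e` preserves the norm and pulls `⟪U a, ·⟫` back to `⟪a, ·⟫`. -/
theorem dualInner_innerDual_map (e : W ≃ₗ[ℂ] V) (U : W ≃ₗᵢ[ℂ] W) (a c : W) :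
    dualInner μ (fun v => ‖e.symm v‖) (innerDual e (U a)) (innerDual e (U c)) =
      dualInner μ (fun v => ‖e.symm v‖) (innerDual e a) (innerDual e c) := by
  let A : V ≃ₗ[ℂ] V := e.symm ≪≫ₗ U.toLinearEquiv ≪≫ₗ e
  have hA : ∀ v, e.symm (A v) = U (e.symm v) := fun v => e.symm_apply_apply _
  have h1 : ∀ a, innerDual e (U a) ∘ₗ A.toLinearMap = innerDual e a := fun a => by
    ext v
    simp only [LinearMap.comp_apply, LinearEquiv.coe_coe, innerDual_apply, hA,
      U.inner_map_map]
  have h2 := dualInner_comp_linearEquiv μ (fun v => ‖e.symm v‖) A (innerDual e (U a))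
    (innerDual e (U c))
  simp only [h1, hA, U.norm_map] at h2
  exact h2.symm

theorem hasFiniteMoments_norm_symm (e : W ≃ₗ[ℂ] V) :
    HasFiniteMoments μ fun v => ‖e.symm v‖ :=
  (isPseudonorm_norm_symm e).hasFiniteMoments μ fun v w => by
    rw [map_add]
    exact norm_add_le _ _

theorem dualInner_innerDual_orthonormal (e : W ≃ₗ[ℂ] V) {ι : Type*} [Fintype ι] [DecidableEq ι]
    (b : OrthonormalBasis ι ℂ W) (i j : ι) :
    dualInner μ (fun v => ‖e.symm v‖) (innerDual e (b i)) (innerDual e (b j)) =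
      if i = j then 1 else 0 := by
  have hF := isPseudonorm_norm_symm e
  have hM := hasFiniteMoments_norm_symm μ e
  have hg := isHermitianInnerProduct_dualInner hF hM
  split_ifs with hij
  · subst hij
    -- The unitary map swapping two basis vectors makes the diagonal entries equal; Parseval then
    -- computes their sum.
    have hdiag : ∀ j, dualInner μ (fun v => ‖e.symm v‖) (innerDual e (b j)) (innerDual e (b j)) =
        dualInner μ (fun v => ‖e.symm v‖) (innerDual e (b i)) (innerDual e (b i)) := fun j => by
      have := dualInner_innerDual_map μ e (b.equiv b (Equiv.swap i j)) (b i) (b i)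
      rwa [OrthonormalBasis.equiv_apply_basis, Equiv.swap_apply_left] at this
    have hsum : ∑ j, dualInner μ (fun v => ‖e.symm v‖) (innerDual e (b j)) (innerDual e (b j)) =
        finrank ℂ V := by
      have hvol := hM.measureReal_pos hF
      have h1 := hF.setIntegral_sq μ fun v w => by
        rw [map_add]
        exact norm_add_le _ _
      simp_rw [dualInner_self]
      rw [← Complex.ofReal_sum, ← Finset.mul_sum,
        ← integral_finsetSum _ fun j _ => hM.integrable_sq _]
      simp_rw [innerDual_apply, b.sum_sq_norm_inner_right]
      rw [h1]
      norm_cast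
      push_cast
      field_simp
    have hcard : finrank ℂ V = Fintype.card ι := by
      rw [← e.finrank_eq, Module.finrank_eq_card_basis b.toBasis]
    rw [Finset.sum_congr rfl fun j _ => hdiag j, Finset.sum_const, Finset.card_univ, hcard,
      nsmul_eq_mul] at hsum
    have : (Fintype.card ι : ℂ) ≠ 0 := Nat.cast_ne_zero.mpr (Fintype.card_pos_iff.mpr ⟨i⟩).ne'
    exact mul_left_cancel₀ this (hsum.trans (mul_one _).symm)
  -- This reflection negates `b i` and fixes `b j`, so the entry equals its own negative.
  · let U : W ≃ₗᵢ[ℂ] W := (ℂ ∙ b i)ᗮ.reflection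
    have hi : U (b i) = -b i := Submodule.reflection_orthogonalComplement_singleton_eq_neg (b i)
    have hj : U (b j) = b j := by
      refine Submodule.reflection_mem_subspace_eq_self ?_
      rw [Submodule.mem_orthogonal_singleton_iff_inner_right]
      exact b.orthonormal.2 hij
    have h1 := dualInner_innerDual_map μ e U (b i) (b j)
    have h2 : innerDual e (-b i) = (-1 : ℂ) • innerDual e (b i) := by
      ext v
      simp [innerDual_apply]
    rw [hi, hj, h2, hg.smul_left, neg_one_mul] at h1
    exact neg_eq_self.mp h1

theorem musical_norm_symm (e : W ≃ₗ[ℂ] V) (v : V) :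
    musical μ (fun v => ‖e.symm v‖) v = innerDual e (e.symm v) := by
  have hF := isPseudonorm_norm_symm e
  have hM := hasFiniteMoments_norm_symm μ e
  have hg := isHermitianInnerProduct_dualInner hF hM
  have : FiniteDimensional ℂ W := e.symm.finiteDimensional
  let b := stdOrthonormalBasis ℂ W
  have hexp : ∀ φ : Dual ℂ V, φ = ∑ i, φ (e (b i)) • innerDual e (b i) := fun φ => by
    ext v
    conv_lhs => rw [← e.apply_symm_apply v, ← b.sum_repr' (e.symm v)]
    simp [innerDual_apply, mul_comm]
  have h1 : ∀ i, dualInner μ (fun v => ‖e.symm v‖) (innerDual e (b i)) (innerDual e (e.symm v)) =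
      inner ℂ (b i) (e.symm v) := fun i => by
    rw [← hg.conj_symm, hexp (innerDual e (e.symm v)), hg.sum_left]
    simp [dualInner_innerDual_orthonormal, innerDual_apply]
  refine musical_eq hF hM fun φ => ?_
  rw [hexp φ, hg.sum_left]
  simp [h1, innerDual_apply]

theorem blInner_eq_of_hermitian {h : V → V → ℂ} (hh : IsHermitianInnerProduct h) {F : V → ℝ}
    (hFh : ∀ v, F v = √(h v v).re) (v w : V) : blInner μ F v w = h v w := by
  obtain ⟨W, _, _, e, he⟩ := hh.exists_innerProductSpace
  have hFe : F = fun v => ‖e.symm v‖ := funext fun v => by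
    rw [hFh, norm_eq_sqrt_re_inner (𝕜 := ℂ), he]
    simp
  rw [hFe, blInner_eq_apply (isPseudonorm_norm_symm e) (hasFiniteMoments_norm_symm μ e),
    musical_norm_symm, innerDual_apply, he]
  simp

end HermitianNorm

/-! ### The squared modulus cut off to a half plane -/

section HalfPlane

/-- The function `‖z‖ ^ 2`, cut off outside of the right half plane. -/
def halfPlaneNormSq : ℂ → ℝ := {z : ℂ | 0 < z.re}.indicator fun z => ‖z‖ ^ 2

theorem halfPlaneNormSq_nonneg (z : ℂ) : 0 ≤ halfPlaneNormSq z :=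
  Set.indicator_nonneg (fun _ _ => by positivity) z

theorem measurable_halfPlaneNormSq : Measurable halfPlaneNormSq :=
  Measurable.indicator (by fun_prop) (isOpen_lt continuous_const Complex.continuous_re).measurableSet

theorem halfPlaneNormSq_le (z : ℂ) : halfPlaneNormSq z ≤ ‖z‖ ^ 2 :=
  Set.indicator_le_self' (fun _ _ => by positivity) z

theorem halfPlaneNormSq_add_neg_le (z : ℂ) :
    halfPlaneNormSq z + halfPlaneNormSq (-z) ≤ ‖z‖ ^ 2 := by
  have h := sq_nonneg ‖z‖
  simp only [halfPlaneNormSq, Set.indicator_apply, Set.mem_ofPred_eq, Complex.neg_re, norm_neg]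
  split_ifs <;> linarith

/-- In the half plane, `(re w)²` already exceeds the left side by `((1 - t) re z)²`; outside it, the
left side is at most `0`. Being affine in `re z`, the left side has an explicit integral over a
symmetric set. -/
theorem le_halfPlaneNormSq {r t : ℝ} (hr : 0 ≤ r) (ht : 0 ≤ t) (z : ℂ) :
    t ^ 2 * r ^ 2 + 2 * t * (1 - t) * r * z.re ≤ halfPlaneNormSq (t * r + (1 - t : ℝ) * z) := by
  have hre : ((t : ℂ) * r + (1 - t : ℝ) * z).re = t * r + (1 - t) * z.re := by simp
  by_cases h : 0 < t * r + (1 - t) * z.re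
  · rw [halfPlaneNormSq, Set.indicator_of_mem (by rwa [Set.mem_ofPred_eq, hre]),
      ← Complex.normSq_eq_norm_sq, Complex.normSq_apply, hre]
    nlinarith [sq_nonneg ((1 - t) * z.re), mul_self_nonneg ((t : ℂ) * r + (1 - t : ℝ) * z).im]
  · refine le_trans ?_ (halfPlaneNormSq_nonneg _)
    have := mul_nonneg (mul_nonneg ht hr) (sub_nonneg.mpr (not_lt.mp h))
    nlinarith [sq_nonneg (t * r)]

end HalfPlane

/-! ### Two-sided bounds under the triangle inequality -/

section TriangleInequality

open Module

theorem IsPseudonorm.exists_dual_eq {V : Type u} [AddCommGroup V] [Module ℂ V]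
    [FiniteDimensional ℂ V] {F : V → ℝ} (hF : IsPseudonorm F)
    (htri : ∀ v w, F (v + w) ≤ F v + F w) (v : V) :
    ∃ y : Dual ℂ V, y v = F v ∧ ∀ x, ‖y x‖ ≤ F x := by
  obtain ⟨W, _, _, e, he⟩ := hF.exists_normedSpace htri
  have hFe : ∀ v, F v = ‖e.symm v‖ := fun v => by rw [he, e.apply_symm_apply]
  obtain ⟨g, hg1, hg2⟩ := exists_dual_vector'' ℂ (e.symm v)
  refine ⟨g.toLinearMap ∘ₗ e.symm.toLinearMap, ?_, fun x => ?_⟩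
  · rw [hFe]
    exact hg2
  · rw [hFe]
    exact (g.le_of_opNorm_le hg1 _).trans_eq (one_mul _)

variable {V : Type u} [NormedAddCommGroup V] [NormedSpace ℂ V] [FiniteDimensional ℂ V]
  [MeasurableSpace V] [BorelSpace V] {μ : Measure V} [μ.IsAddHaarMeasure] {F : V → ℝ}

theorem le_finrank_add_one_mul_blNorm_sq (hF : IsPseudonorm F)
    (htri : ∀ v w, F (v + w) ≤ F v + F w) (v : V) :
    F v ^ 2 ≤ ((finrank ℂ V : ℝ) + 1) * blNorm μ F v ^ 2 := by
  have hM := hF.hasFiniteMoments μ htri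
  obtain ⟨y, hyv, hy⟩ := hF.exists_dual_eq htri v
  have h1 := norm_apply_sq_le hF hM v y
  rw [hyv, Complex.norm_real, Real.norm_eq_abs, sq_abs] at h1
  refine h1.trans ?_
  gcongr
  have hvol := hM.measureReal_pos hF
  have h2 := norm_setIntegral_le_of_norm_le_const (f := fun η => ‖y η‖ ^ 2) (C := 1)
    hM.volume_ne_top.lt_top (fun x (hx : F x < 1) => by
      rw [Real.norm_eq_abs, abs_of_nonneg (by positivity)]
      exact pow_le_one₀ (norm_nonneg _) ((hy x).trans hx.le))
  rw [one_mul] at h2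
  rw [re_dualInner_self, div_mul_eq_mul_div, div_le_iff₀ hvol]
  gcongr
  exact (Real.le_norm_self _).trans h2

/-- The cut-off integrand is integrated over the shrunken ball `tv + (1 - t)Ω ⊆ Ω`, whose Jacobian
is `(1 - t)^(2n)`. The factor `2` is gained because `Ω = -Ω` and the half planes of `y` and `-y` are
disjoint. -/
theorem le_setIntegral_normSq (hF : IsPseudonorm F) (htri : ∀ v w, F (v + w) ≤ F v + F w)
    (y : Dual ℂ V) {v : V} (hv : F v ≤ 1) {r : ℝ} (hr : 0 ≤ r) (hyv : y v = r) {t : ℝ}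
    (ht0 : 0 ≤ t) (ht1 : t < 1) :
    2 * t ^ 2 * (1 - t) ^ (2 * finrank ℂ V) * r ^ 2 * μ.real (unitBall F) ≤
      ∫ η in unitBall F, ‖y η‖ ^ 2 ∂μ := by
  have hM := hF.hasFiniteMoments μ htri
  have hΩ := hM.nullMeasurableSet
  have hyc := continuous_dual y
  have hs : 0 < 1 - t := sub_pos.mpr ht1
  set H : V → ℝ := (unitBall F).indicator fun x => halfPlaneNormSq (y x) with hHdef
  have hG : IntegrableOn (fun x => halfPlaneNormSq (y x)) (unitBall F) μ := by
    refine (hM.integrable_sq y).mono' ?_ (Filter.Eventually.of_forall fun x => ?_)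
    · exact (measurable_halfPlaneNormSq.comp hyc.measurable).aestronglyMeasurable
    · rw [Real.norm_eq_abs, abs_of_nonneg (halfPlaneNormSq_nonneg _)]
      exact halfPlaneNormSq_le _
  have hH : Integrable H μ := hG.integrable_indicator₀ hΩ
  have hHneg : Integrable (fun x => H (-x)) μ := hH.comp_neg
  have hIneg : ∫ x, H (-x) ∂μ = ∫ x, H x ∂μ := integral_neg_eq_self H μ
  have hmem_neg : ∀ x, -x ∈ unitBall F ↔ x ∈ unitBall F := fun x => by
    simp only [unitBall, Set.mem_ofPred_eq, hF.neg]
  have hsq : Integrable ((unitBall F).indicator fun x => ‖y x‖ ^ 2) μ :=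
    (hM.integrable_sq y).integrable_indicator₀ hΩ
  have hA : 2 * ∫ x, H x ∂μ ≤ ∫ η in unitBall F, ‖y η‖ ^ 2 ∂μ := by
    rw [← integral_indicator₀ hΩ, two_mul]
    nth_rw 2 [← hIneg]
    rw [← integral_add hH hHneg]
    refine integral_mono (hH.add hHneg) hsq fun x => ?_
    by_cases hx : x ∈ unitBall F
    · simp only [hHdef, Set.indicator_of_mem hx, Set.indicator_of_mem ((hmem_neg x).mpr hx),
        map_neg]
      exact halfPlaneNormSq_add_neg_le _
    · simp only [hHdef, Set.indicator_of_notMem hx,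
        Set.indicator_of_notMem (mt (hmem_neg x).mp hx), add_zero, le_refl]
  have hB : ∫ x, H (t • v + (1 - t) • x) ∂μ =
      ((1 - t) ^ (2 * finrank ℂ V))⁻¹ * ∫ x, H x ∂μ := by
    rw [Measure.integral_comp_smul_of_nonneg μ (fun x => H (t • v + x)) (1 - t) (hR := hs.le),
      integral_add_left_eq_self, finrank_real_of_complex, smul_eq_mul]
  have hHaff : Integrable (fun x => H (t • v + (1 - t) • x)) μ :=
    (hH.comp_add_left (t • v)).comp_smul hs.ne'
  have hre : IntegrableOn (fun x => (y x).re) (unitBall F) μ := by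
    have hadd : IntegrableOn (fun x => ‖y x‖ ^ 2 + 1) (unitBall F) μ :=
      (hM.integrable_sq y).add (integrableOn_const hM.volume_ne_top)
    refine hadd.mono' (Complex.continuous_re.comp hyc).aestronglyMeasurable
      (Filter.Eventually.of_forall fun x => ?_)
    rw [Real.norm_eq_abs]
    nlinarith [Complex.abs_re_le_norm (y x), sq_nonneg (‖y x‖ - 1), sq_nonneg ‖y x‖]
  -- The ball is symmetric and the integrand odd, so the linear term of `le_halfPlaneNormSq` drops
  -- out.
  have hodd : ∫ x in unitBall F, (y x).re ∂μ = 0 := by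
    rw [← integral_indicator₀ hΩ]
    have h := integral_neg_eq_self ((unitBall F).indicator fun x => (y x).re) μ
    have h2 : ∀ x, (unitBall F).indicator (fun x => (y x).re) (-x) =
        -(unitBall F).indicator (fun x => (y x).re) x := fun x => by
      by_cases hx : x ∈ unitBall F
      · simp [Set.indicator_of_mem hx, Set.indicator_of_mem ((hmem_neg x).mpr hx)]
      · simp [Set.indicator_of_notMem hx, Set.indicator_of_notMem (mt (hmem_neg x).mp hx)]
    simp_rw [h2] at h
    rw [integral_neg] at h
    linarith
  have hconst : IntegrableOn (fun _ : V => t ^ 2 * r ^ 2) (unitBall F) μ :=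
    integrableOn_const hM.volume_ne_top
  have hlin : IntegrableOn (fun x => t ^ 2 * r ^ 2 + 2 * t * (1 - t) * r * (y x).re)
      (unitBall F) μ := hconst.add (hre.const_mul _)
  have hC : t ^ 2 * r ^ 2 * μ.real (unitBall F) ≤ ∫ x, H (t • v + (1 - t) • x) ∂μ := by
    have h1 : ∫ x in unitBall F, (t ^ 2 * r ^ 2 + 2 * t * (1 - t) * r * (y x).re) ∂μ =
        t ^ 2 * r ^ 2 * μ.real (unitBall F) := by
      rw [integral_add hconst (hre.const_mul _), integral_const_mul (2 * t * (1 - t) * r),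
        hodd, setIntegral_const, smul_eq_mul]
      ring
    rw [← h1, ← integral_indicator₀ hΩ]
    refine integral_mono (hlin.integrable_indicator₀ hΩ) hHaff fun x => ?_
    by_cases hx : x ∈ unitBall F
    · have hx' : t • v + (1 - t) • x ∈ unitBall F := by
        have hx1 : F x < 1 := hx
        refine (htri _ _).trans_lt ?_
        rw [hF.smul_real, hF.smul_real, abs_of_nonneg ht0, abs_of_pos hs]
        nlinarith
      have hy : y (t • v + (1 - t) • x) = t * r + (1 - t : ℝ) * y x := by
        rw [← Complex.coe_smul, ← Complex.coe_smul, map_add, map_smul, map_smul, hyv]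
        rfl
      simp only [hHdef, Set.indicator_of_mem hx, Set.indicator_of_mem hx', hy]
      exact le_halfPlaneNormSq hr ht0 _
    · rw [Set.indicator_of_notMem hx]
      exact Set.indicator_nonneg (fun _ _ => halfPlaneNormSq_nonneg _) _
  rw [hB, le_inv_mul_iff₀ (by positivity)] at hC
  linarith

/-- The numerical core of the upper bound. At `n = 2` it reads `243 ≤ 256`, so the factor `2` is
indispensable; it fails at `n = 1`. -/
theorem add_one_pow_le_two_mul_pow {n : ℕ} (hn : 2 ≤ n) :
    (n + 1) ^ (2 * n + 1) ≤ 2 * n ^ (3 * n + 1) := by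
  rcases hn.eq_or_lt with rfl | hn
  · norm_num
  · have h1 : (n + 1) ^ 2 ≤ n ^ 3 := by nlinarith [Nat.mul_le_mul hn hn]
    calc (n + 1) ^ (2 * n + 1) = ((n + 1) ^ 2) ^ n * (n + 1) := by rw [pow_succ, pow_mul]
      _ ≤ (n ^ 3) ^ n * (2 * n) := by gcongr; omega
      _ = 2 * n ^ (3 * n + 1) := by rw [← pow_mul]; ring

theorem norm_apply_sq_le_pow_mul (hF : IsPseudonorm F) (htri : ∀ v w, F (v + w) ≤ F v + F w)
    (hn : 2 ≤ finrank ℂ V) (y : Dual ℂ V) (v : V) :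
    ‖y v‖ ^ 2 ≤ (finrank ℂ V : ℝ) ^ (finrank ℂ V + 1) * F v ^ 2 * (dualInner μ F y y).re := by
  have hM := hF.hasFiniteMoments μ htri
  have hQ := (isHermitianInnerProduct_dualInner hF hM).re_self_nonneg y
  by_cases hyv : y v = 0
  · rw [hyv, norm_zero, zero_pow two_ne_zero]
    positivity
  have hv : v ≠ 0 := fun h => hyv (by rw [h, map_zero])
  have hFv : 0 < F v := lt_of_le_of_ne (hF.nonneg v) fun h => hv ((hF.eq_zero_iff v).mp h.symm)
  have hyn : 0 < ‖y v‖ := norm_pos_iff.mpr hyv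
  have hync : (‖y v‖ : ℂ) ≠ 0 := Complex.ofReal_ne_zero.mpr hyn.ne'
  have hFvc : (F v : ℂ) ≠ 0 := Complex.ofReal_ne_zero.mpr hFv.ne'
  -- Scaling by `c` normalizes `v` to `F = 1` and rotates `y v` to the positive real axis.
  set c : ℂ := (starRingEnd ℂ) (y v) / (‖y v‖ * F v) with hc
  have hFc : F (c • v) ≤ 1 := by
    rw [hF.smul, hc, norm_div, norm_mul, Complex.norm_real, Complex.norm_real, norm_norm,
      RCLike.norm_conj, Real.norm_eq_abs, abs_of_pos hFv]
    refine le_of_eq ?_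
    field_simp
  have hyc : y (c • v) = (‖y v‖ / F v : ℝ) := by
    rw [map_smul, smul_eq_mul, hc, div_mul_eq_mul_div, mul_comm _ (y v), Complex.mul_conj,
      Complex.normSq_eq_norm_sq]
    push_cast
    field_simp
  set n := finrank ℂ V with hndef
  have hn0 : (0 : ℝ) < n := by exact_mod_cast (by omega : 0 < n)
  have hn1 : (0 : ℝ) < n + 1 := by positivity
  -- The value `t = 1 / (n + 1)` maximizes `t² (1 - t)^(2n)`.
  have h1 := le_setIntegral_normSq (μ := μ) hF htri y hFc (div_nonneg hyn.le hFv.le) hyc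
    (t := 1 / (n + 1)) (by positivity) (by rw [div_lt_one hn1]; linarith)
  have hvol := hM.measureReal_pos hF
  have h2 : (1 : ℝ) - 1 / (n + 1) = n / (n + 1) := by field_simp; ring
  rw [h2, ← hndef] at h1
  have h3 : ((n : ℝ) + 1) ^ (2 * n + 1) ≤ 2 * (n : ℝ) ^ (3 * n + 1) := by
    exact_mod_cast add_one_pow_le_two_mul_pow hn
  rw [re_dualInner_self, ← hndef]
  have h4 : ((n : ℝ) + 1) / μ.real (unitBall F) *
      (2 * (1 / ((n : ℝ) + 1)) ^ 2 * (n / (n + 1)) ^ (2 * n) * (‖y v‖ / F v) ^ 2 *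
        μ.real (unitBall F)) =
      2 * (n : ℝ) ^ (2 * n) / (n + 1) ^ (2 * n + 1) * (‖y v‖ / F v) ^ 2 := by
    rw [div_pow (n : ℝ)]
    field_simp
    exact pow_succ' _ _
  calc ‖y v‖ ^ 2 ≤ ‖y v‖ ^ 2 * (2 * (n : ℝ) ^ (3 * n + 1) / ((n : ℝ) + 1) ^ (2 * n + 1)) :=
        le_mul_of_one_le_right (by positivity) ((one_le_div (by positivity)).mpr h3)
    _ = (n : ℝ) ^ (n + 1) * F v ^ 2 *
        (2 * (n : ℝ) ^ (2 * n) / (n + 1) ^ (2 * n + 1) * (‖y v‖ / F v) ^ 2) := by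
      field_simp
      ring
    _ ≤ _ := by
      rw [← h4]
      gcongr

theorem blNorm_sq_le_pow_mul (hF : IsPseudonorm F) (htri : ∀ v w, F (v + w) ≤ F v + F w)
    (hn : 2 ≤ finrank ℂ V) (v : V) :
    blNorm μ F v ^ 2 ≤ (finrank ℂ V : ℝ) ^ (finrank ℂ V + 1) * F v ^ 2 := by
  have hM := hF.hasFiniteMoments μ htri
  have h1 := norm_apply_sq_le_pow_mul (μ := μ) hF htri hn (musical μ F v) v
  rw [re_dualInner_musical_self hF hM, apply_musical_self hF hM, Complex.norm_real,
    Real.norm_eq_abs, sq_abs, sq (blNorm μ F v ^ 2)] at h1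
  by_cases hv : v = 0
  · rw [← re_dualInner_musical_self hF hM, ← apply_eq_dualInner_musical hF hM, hv, map_zero,
      Complex.zero_re]
    have := sq_nonneg (F 0)
    positivity
  · exact le_of_mul_le_mul_right h1 (pow_pos (blNorm_pos hF hM hv) 2)

/-- On a complex line `F = |y|` for a functional `y`, so `F` comes from the Hermitian form `y u *
conj (y w)`. -/
theorem blNorm_eq_of_finrank_eq_one (hF : IsPseudonorm F)
    (htri : ∀ v w, F (v + w) ≤ F v + F w) (hn : finrank ℂ V = 1) (v : V) :
    blNorm μ F v = F v := by
  obtain ⟨v₀, -, hv₀⟩ := finrank_eq_one_iff'.mp hn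
  obtain ⟨y, hyv₀, -⟩ := hF.exists_dual_eq htri v₀
  have hy : ∀ v, ‖y v‖ = F v := fun v => by
    obtain ⟨c, rfl⟩ := hv₀ v
    rw [map_smul, norm_smul, hyv₀, hF.smul, Complex.norm_real, Real.norm_eq_abs,
      abs_of_nonneg (hF.nonneg _)]
  have hself : ∀ v, (y v * (starRingEnd ℂ) (y v)).re = F v ^ 2 := fun v => by
    rw [Complex.mul_conj, Complex.ofReal_re, Complex.normSq_eq_norm_sq, hy]
  have hh : IsHermitianInnerProduct fun u w => y u * (starRingEnd ℂ) (y w) :=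
    { add_left := fun u v w => by simp only [map_add, add_mul]
      smul_left := fun c v w => by simp only [map_smul, smul_eq_mul, mul_assoc]
      conj_symm := fun v w => by simp [mul_comm]
      pos := fun v hv => by
        rw [hself]
        exact sq_pos_of_ne_zero (mt (hF.eq_zero_iff v).mp hv) }
  rw [blNorm, blInner_eq_of_hermitian μ hh (F := F) (fun v => by
    rw [hself, Real.sqrt_sq (hF.nonneg v)]), hself, Real.sqrt_sq (hF.nonneg v)]

theorem blNorm_bounds_of_triangle (hF : IsPseudonorm F)
    (htri : ∀ v w, F (v + w) ≤ F v + F w) (v : V) :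
    1 / (finrank ℂ V : ℝ) ^ (((finrank ℂ V : ℝ) + 1) / 2) * F v ≤ blNorm μ F v ∧
      blNorm μ F v ≤ (finrank ℂ V : ℝ) ^ (((finrank ℂ V : ℝ) + 1) / 2) * F v := by
  have hM := hF.hasFiniteMoments μ htri
  have hN : 0 ≤ blNorm μ F v := Real.sqrt_nonneg _
  rcases Nat.lt_or_ge (finrank ℂ V) 2 with hn | hn
  · interval_cases hfr : finrank ℂ V
    · have : Subsingleton V := finrank_zero_iff.mp hfr
      have h0 : blNorm μ F v = 0 := by
        rw [← sq_eq_zero_iff, ← Complex.ofReal_eq_zero, ← apply_musical_self hF hM,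
          Subsingleton.elim v 0, map_zero]
      rw [h0, (hF.eq_zero_iff v).mpr (Subsingleton.elim _ _)]
      simp
    · rw [blNorm_eq_of_finrank_eq_one hF htri hfr]
      simp
  · have hn0 : (0 : ℝ) < finrank ℂ V := by exact_mod_cast (by omega : 0 < finrank ℂ V)
    have hlow := le_finrank_add_one_mul_blNorm_sq (μ := μ) hF htri v
    have hup := blNorm_sq_le_pow_mul (μ := μ) hF htri hn v
    have hFv := hF.nonneg v
    set n := finrank ℂ V
    set C : ℝ := (n : ℝ) ^ (((n : ℝ) + 1) / 2) with hCdef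
    have hC : 0 < C := Real.rpow_pos_of_pos hn0 _
    have hC2 : C ^ 2 = (n : ℝ) ^ (n + 1) := by
      rw [hCdef, ← Real.rpow_natCast, ← Real.rpow_mul hn0.le, ← Real.rpow_natCast]
      congr 1
      push_cast
      ring
    -- The factor `n + 1` of the lower bound is absorbed into `n^(n+1)`, which needs `n ≥ 2`.
    have hle : (n : ℝ) + 1 ≤ C ^ 2 := by
      rw [hC2]
      have : n + 1 ≤ n ^ (n + 1) := (Nat.lt_pow_self (by omega)).le
      exact_mod_cast this
    rw [← hC2, ← mul_pow] at hup
    refine ⟨?_, (sq_le_sq₀ hN (by positivity)).mp hup⟩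
    rw [one_div, inv_mul_le_iff₀ hC]
    refine (sq_le_sq₀ hFv (by positivity)).mp (hlow.trans ?_)
    rw [mul_pow]
    gcongr

end TriangleInequality

end BinetLegendre

end

theorem proposition2p2 {V : Type*} [NormedAddCommGroup V] [NormedSpace ℂ V]
    [FiniteDimensional ℂ V] [MeasurableSpace V] [BorelSpace V]
    (μ : Measure V) [μ.IsAddHaarMeasure] (n : ℕ) (hn : Module.finrank ℂ V = n) :
    -- the construction is well defined
    (∀ F : V → ℝ, IsPseudonorm F → HasFiniteMoments μ F →
      IsHermitianInnerProduct (dualInner μ F) ∧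
      (∀ (v : V) (φ : Module.Dual ℂ V), φ v = dualInner μ F φ (musical μ F v)) ∧
      IsHermitianInnerProduct (blInner μ F)) ∧
    -- (1)
    (∀ (F : V → ℝ) (h : V → V → ℂ), IsHermitianInnerProduct h →
      (∀ v, F v = √(h v v).re) → ∀ v w, blInner μ F v w = h v w) ∧
    -- (2)
    (∀ F : V → ℝ, IsPseudonorm F → HasFiniteMoments μ F → ∀ A : V ≃ₗ[ℂ] V,
      ∀ u v, blInner μ (fun x => F (A x)) u v = blInner μ F (A u) (A v)) ∧
    -- (3)
    (∀ F₁ F₂ : V → ℝ, IsPseudonorm F₁ → HasFiniteMoments μ F₁ →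
      IsPseudonorm F₂ → HasFiniteMoments μ F₂ → ∀ α β : ℝ, 0 < α → 0 < β →
      (∀ v, α * F₁ v ≤ F₂ v ∧ F₂ v ≤ β * F₁ v) →
      ∀ v, α ^ (n + 1) / β ^ n * blNorm μ F₁ v ≤ blNorm μ F₂ v ∧
        blNorm μ F₂ v ≤ β ^ (n + 1) / α ^ n * blNorm μ F₁ v) ∧
    -- (4)
    (∀ F₁ F₂ : V → ℝ, IsPseudonorm F₁ → HasFiniteMoments μ F₁ →
      IsPseudonorm F₂ → HasFiniteMoments μ F₂ →
      -- equality at one nonzero vector forces proportionality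
      (∀ α β : ℝ, 0 < α → 0 < β → (∀ v, α * F₁ v ≤ F₂ v ∧ F₂ v ≤ β * F₁ v) →
        ∀ v, v ≠ 0 →
          (α ^ (n + 1) / β ^ n * blNorm μ F₁ v = blNorm μ F₂ v ∨
            blNorm μ F₂ v = β ^ (n + 1) / α ^ n * blNorm μ F₁ v) →
          α = β ∧ ∀ w, F₂ w = β * F₁ w) ∧
      -- the equivalence
      (1 ≤ n →
        ((∃ α β : ℝ, 0 < α ∧ 0 < β ∧ (∀ v, α * F₁ v ≤ F₂ v ∧ F₂ v ≤ β * F₁ v) ∧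
          ∃ v, v ≠ 0 ∧
            (α ^ (n + 1) / β ^ n * blNorm μ F₁ v = blNorm μ F₂ v ∨
              blNorm μ F₂ v = β ^ (n + 1) / α ^ n * blNorm μ F₁ v)) ↔
          ∃ β : ℝ, 0 < β ∧ ∀ v, F₂ v = β * F₁ v)) ∧
      (∀ β : ℝ, 0 < β → (∀ v, F₂ v = β * F₁ v) →
        ∀ v w, blInner μ F₂ v w = (β : ℂ) ^ 2 * blInner μ F₁ v w)) ∧
    -- (5)
    (∀ F : V → ℝ, IsPseudonorm F → (∀ v w, F (v + w) ≤ F v + F w) →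
      ∀ v, 1 / (n : ℝ) ^ (((n : ℝ) + 1) / 2) * F v ≤ blNorm μ F v ∧
        blNorm μ F v ≤ (n : ℝ) ^ (((n : ℝ) + 1) / 2) * F v) := by
  subst hn
  refine ⟨fun F hF hM => ⟨isHermitianInnerProduct_dualInner hF hM,
      fun v φ => apply_eq_dualInner_musical hF hM v φ, isHermitianInnerProduct_blInner hF hM⟩,
    fun F h hh hFh => blInner_eq_of_hermitian μ hh hFh,
    fun F hF hM A => blInner_comp_linearEquiv hF hM A,
    fun F₁ F₂ hF₁ hM₁ hF₂ hM₂ α β hα hβ h v =>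
      ⟨le_blNorm hF₁ hM₁ hF₂ hM₂ hα hβ h v, blNorm_le hF₁ hM₁ hF₂ hM₂ hα hβ h v⟩,
    fun F₁ F₂ hF₁ hM₁ hF₂ hM₂ => ?_,
    fun F hF htri => blNorm_bounds_of_triangle hF htri⟩
  have rigid : ∀ α β : ℝ, 0 < α → 0 < β → (∀ v, α * F₁ v ≤ F₂ v ∧ F₂ v ≤ β * F₁ v) →
      ∀ v, v ≠ 0 →
        (α ^ (Module.finrank ℂ V + 1) / β ^ Module.finrank ℂ V * blNorm μ F₁ v =
            blNorm μ F₂ v ∨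
          blNorm μ F₂ v =
            β ^ (Module.finrank ℂ V + 1) / α ^ Module.finrank ℂ V * blNorm μ F₁ v) →
        α = β ∧ ∀ w, F₂ w = β * F₁ w := by
    intro α β hα hβ h v hv heq
    have hαβ : α = β := heq.elim (eq_of_eq_blNorm hF₁ hM₁ hF₂ hM₂ hα hβ h hv)
      (eq_of_blNorm_eq hF₁ hM₁ hF₂ hM₂ hα hβ h hv)
    -- Once `α = β`, the two-sided comparison gives proportionality at every vector, not just almost
    -- everywhere.
    exact ⟨hαβ, fun w => le_antisymm (h w).2 (hαβ ▸ (h w).1)⟩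
  refine ⟨rigid, fun hn => ⟨?_, ?_⟩, fun β hβ h v w => ?_⟩
  · rintro ⟨α, β, hα, hβ, h, v, hv, heq⟩
    exact ⟨β, hβ, (rigid α β hα hβ h v hv heq).2⟩
  · rintro ⟨β, hβ, h⟩
    have : Nontrivial V := Module.nontrivial_of_finrank_pos (R := ℂ) hn
    obtain ⟨v, hv⟩ := exists_ne (0 : V)
    refine ⟨β, β, hβ, hβ, fun v => ⟨(h v).ge, (h v).le⟩, v, hv, Or.inr ?_⟩
    rw [funext h, blNorm_const_mul hF₁ hM₁ hβ, pow_succ', mul_div_cancel_right₀ _ (by positivity)]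
  · rw [funext h, blInner_const_mul hF₁ hM₁ hβ]
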